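/- Conventions (continuous logic). A one-sorted, $1$-bounded metric signature $L$ consists of function and predicate symbols, each with an arity and a modulus of uniform continuity $\Delta\colon(0,1]\to(0,1]$. An $L$-structure is a nonempty complete metric space of diameter at most $1$ together with interpretations of the function symbols, and of the predicate symbols as $[0,1]$-valued functions, each respecting its modulus: $d(a,b)<\Delta(\varepsilon)$ (maximum metric on tuples) implies that the values at $a$ and $b$ differ by at most $\varepsilon$. Formulas are built from $d$ and the symbols of $L$ with all continuous connectives $[0,1]^k\to[0,1]$ and the quantifiers $\sup$, $\inf$. An $L$-structure $M$ is *pseudofinite* if $\sigma^M=0$ for every $L$-sentence $\sigma$ with $\sigma^A=0$ for all finite $L$-structures $A$; it is *strongly pseudofinite* (resp. *strongly pseudocompact*) if for every $L$-sentence $\sigma$ with $\sigma^M=0$ there is a finite (resp. compact) $L$-structure $A$ with $\sigma^A=0$. A map $f\colon M\to M$ is *formula-definable* if there are an $L$-formula $\varphi(x,y,z)$ and a tuple $a$ from $M$ with $d(f(x),y)=\varphi^M(x,y,a)$ for all $x,y\in M$. For a cardinal $\kappa$, $M$ is *$\kappa$-saturated* if, for every $A\subseteq M$ with $|A|<\kappa$,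 every set of conditions $\varphi(x,a)=0$ with parameters from $A$, in a finite tuple $x$ of variables, all of whose finite subsets are satisfiable in $M$, is satisfiable in $M$. Statement. Let $\mathbb{S}^1=\{z\in\mathbb{C}: |z|=1\}$ with the metric $d(z,w)=\tfrac12|z-w|$, and let $P(u,v,w)=d(uv,w)$. Then $P$ respects some modulus of uniform continuity. For every modulus $\Delta$ that $P$ respects, consider $(\mathbb{S}^1,P)$ as a structure in the signature whose only symbol is a ternary predicate symbol with modulus $\Delta$. Then: 1. $(\mathbb{S}^1,P)$ is compact, pseudofinite, strongly pseudocompact, and $\kappa$-saturated for every cardinal $\kappa$; 2. the map $f(z)=z^2$ satisfies $d(f(z),w)=P(z,z,w)$ for all $z,w\in\mathbb{S}^1$; it is formula-definable in $(\mathbb{S}^1,P)$, surjective, and not injective; 3. $(\mathbb{S}^1,P)$ is not strongly pseudofinite. Consequently there is a metric structure that is pseudofinite but not strongly pseudofinite, and there is a metric structure that is strongly pseudocompact but not strongly pseudofinite. -/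

import Mathlib

universe u v

namespace ContLogic

/-- A modulus of uniform continuity: an arbitrary function from `(0,1]` to `(0,1]`. -/
abbrev Modulus : Type := Set.Ioc (0 : ℝ) 1 → Set.Ioc (0 : ℝ) 1

/-- `f` respects the modulus `Δ`: `d(x,y) < Δ(ε)` implies `d(f x, f y) ≤ ε`. -/
def Respects {X Y : Type*} [PseudoMetricSpace X] [PseudoMetricSpace Y]
    (Δ : Modulus) (f : X → Y) : Prop :=
  ∀ (ε : Set.Ioc (0 : ℝ) 1) (x y : X), dist x y < (Δ ε : ℝ) → dist (f x) (f y) ≤ (ε : ℝ)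

/-- A one-sorted, `1`-bounded metric signature. Constant symbols are function symbols of
arity `0`; the metric is a logical symbol and is not listed. -/
structure Signature where
  Func : Type u
  funcArity : Func → ℕ
  funcModulus : Func → Modulus
  Pred : Type u
  predArity : Pred → ℕ
  predModulus : Pred → Modulus

/-- A metric structure for `L`: a nonempty complete metric space of diameter at most `1`, with
interpretations of the symbols that respect the prescribed moduli. Tuples `Fin n → carrier` carry
the maximum metric, and `unitInterval` the usual metric. -/
structure Structure (L : Signature.{u}) where
  carrier : Type v
  [metric : MetricSpace carrier]
  [complete : CompleteSpace carrier]
  [nonempty : Nonempty carrier]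
  dist_le_one : ∀ x y : carrier, dist x y ≤ 1
  func : ∀ f : L.Func, (Fin (L.funcArity f) → carrier) → carrier
  func_respects : ∀ f : L.Func, Respects (L.funcModulus f) (func f)
  pred : ∀ P : L.Pred, (Fin (L.predArity P) → carrier) → unitInterval
  pred_respects : ∀ P : L.Pred, Respects (L.predModulus P) (pred P)

attribute [instance] Structure.metric Structure.complete Structure.nonempty

/-- Terms in the variables `x₀, …, xₙ₋₁`. -/
inductive Term (L : Signature.{u}) (n : ℕ) : Type u where
  | var : Fin n → Term L n
  | app (f : L.Func) : (Fin (L.funcArity f) → Term L n) → Term L n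

/-- Formulas of continuous logic with free variables among `x₀, …, xₙ₋₁`. The connectives are all
continuous functions `[0,1]^k → [0,1]`; the quantifiers bind the last variable. -/
inductive Formula (L : Signature.{u}) : ℕ → Type u where
  | dist {n : ℕ} : Term L n → Term L n → Formula L n
  | pred {n : ℕ} (P : L.Pred) : (Fin (L.predArity P) → Term L n) → Formula L n
  | conn {n k : ℕ} (c : C(Fin k → unitInterval, unitInterval)) :
      (Fin k → Formula L n) → Formula L n
  | sup {n : ℕ} : Formula L (n + 1) → Formula L n
  | inf {n : ℕ} : Formula L (n + 1) → Formula L n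

/-- Sentences are formulas without free variables. -/
abbrev Sentence (L : Signature.{u}) : Type u := Formula L 0

/-- Value of a term in `M`. -/
def Term.eval {L : Signature.{u}} (M : Structure.{u, v} L) {n : ℕ} (x : Fin n → M.carrier) :
    Term L n → M.carrier
  | .var i => x i
  | .app f ts => M.func f (fun i => (ts i).eval M x)

/-- Value of a formula in `M`, an element of `[0,1]`. -/
noncomputable def Formula.eval {L : Signature.{u}} (M : Structure.{u, v} L) :
    {n : ℕ} → Formula L n → (Fin n → M.carrier) → unitInterval
  | _, .dist s t, x => ⟨Dist.dist (s.eval M x) (t.eval M x), dist_nonneg, M.dist_le_one _ _⟩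
  | _, .pred P ts, x => M.pred P (fun i => (ts i).eval M x)
  | _, .conn c φ, x => c (fun i => (φ i).eval M x)
  | _, .sup φ, x => ⨆ y : M.carrier, φ.eval M (Fin.snoc x y)
  | _, .inf φ, x => ⨅ y : M.carrier, φ.eval M (Fin.snoc x y)

/-- The value `σ^M` of a sentence. -/
noncomputable def Sentence.value {L : Signature.{u}} (σ : Sentence L) (M : Structure.{u, v} L) :
    unitInterval :=
  Formula.eval M σ Fin.elim0

namespace Structure

variable {L : Signature.{u}}

/-- Finite structures. -/
def IsFinite (M : Structure.{u, v} L) : Prop := Finite M.carrier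

/-- Compact structures. -/
def IsCompact (M : Structure.{u, v} L) : Prop := CompactSpace M.carrier

/-- `M` is pseudofinite. (Every universe contains copies of all finite structures.) -/
def Pseudofinite (M : Structure.{u, v} L) : Prop :=
  ∀ σ : Sentence L, (∀ A : Structure.{u, v} L, A.IsFinite → σ.value A = 0) → σ.value M = 0

/-- `M` is strongly pseudofinite. -/
def StronglyPseudofinite (M : Structure.{u, v} L) : Prop :=
  ∀ σ : Sentence L, σ.value M = 0 → ∃ A : Structure.{u, v} L, A.IsFinite ∧ σ.value A = 0

/-- `M` is strongly pseudocompact. (Compact metric spaces have at most the cardinality of the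
continuum, so every universe contains copies of all compact structures.) -/
def StronglyPseudocompact (M : Structure.{u, v} L) : Prop :=
  ∀ σ : Sentence L, σ.value M = 0 → ∃ A : Structure.{u, v} L, A.IsCompact ∧ σ.value A = 0

/-- `f : M → M` is formula-definable: for some formula `φ(x,y,z)` and some tuple `a` of parameters,
`d(f(x),y) = φ(x,y,a)` for all `x, y`. -/
def FormulaDefinable (M : Structure.{u, v} L) (f : M.carrier → M.carrier) : Prop :=
  ∃ (m : ℕ) (φ : Formula L (2 + m)) (a : Fin m → M.carrier),
    ∀ x y : M.carrier, dist (f x) y = (φ.eval M (Fin.append ![x, y] a) : ℝ)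

/-- A condition `φ(x,a) = 0` in `n` variables `x`, with parameters `a` from `A`. -/
structure Condition (M : Structure.{u, v} L) (A : Set M.carrier) (n : ℕ) where
  numParams : ℕ
  formula : Formula L (n + numParams)
  params : Fin numParams → A

/-- The tuple `x` satisfies the condition. -/
def Condition.Holds {M : Structure.{u, v} L} {A : Set M.carrier} {n : ℕ}
    (c : M.Condition A n) (x : Fin n → M.carrier) : Prop :=
  c.formula.eval M (Fin.append x (fun i => (c.params i : M.carrier))) = 0

/-- `M` is `κ`-saturated: for every parameter set `A` of cardinality less than `κ`, every finitely
satisfiable set of conditions over `A` in finitely many variables is satisfiable in `M`. -/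
def Saturated (M : Structure.{u, v} L) (κ : Cardinal.{v}) : Prop :=
  ∀ A : Set M.carrier, Cardinal.mk A < κ →
    ∀ (n : ℕ) (Γ : Set (M.Condition A n)),
      (∀ Γ₀ : Set (M.Condition A n), Γ₀ ⊆ Γ → Γ₀.Finite →
        ∃ x : Fin n → M.carrier, ∀ c ∈ Γ₀, c.Holds x) →
      ∃ x : Fin n → M.carrier, ∀ c ∈ Γ, c.Holds x

end Structure

/-- The unit circle in `ℂ`, to be equipped with half of the metric induced by `ℂ`. -/
def HalfCircle : Type := Circle

namespace HalfCircle

noncomputable instance : CommGroup HalfCircle := inferInstanceAs (CommGroup Circle)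

/-- The underlying complex number. -/
noncomputable def toComplex (z : HalfCircle) : ℂ := Circle.coeHom z

noncomputable instance : MetricSpace HalfCircle where
  dist z w := ‖z.toComplex - w.toComplex‖ / 2
  dist_self z := by simp
  dist_comm z w := by rw [norm_sub_rev]
  dist_triangle x y z := by
    have := norm_sub_le_norm_sub_add_norm_sub x.toComplex y.toComplex z.toComplex
    linarith
  eq_of_dist_eq_zero {z w} h := by
    have h' : ‖z.toComplex - w.toComplex‖ / 2 = 0 := h
    have h2 : z.toComplex = w.toComplex := by
      rw [← sub_eq_zero, ← norm_eq_zero]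
      linarith
    exact Circle.coe_injective h2

theorem dist_eq (z w : HalfCircle) : dist z w = ‖z.toComplex - w.toComplex‖ / 2 := rfl

instance : Nonempty HalfCircle := ⟨1⟩

theorem dist_le_one (z w : HalfCircle) : dist z w ≤ 1 := by
  have h := norm_sub_le z.toComplex w.toComplex
  have h1 : ‖z.toComplex‖ = 1 := Circle.norm_coe z
  have h2 : ‖w.toComplex‖ = 1 := Circle.norm_coe w
  rw [dist_eq]
  linarith

instance : CompactSpace HalfCircle := by
  let f : Circle → HalfCircle := fun z => z
  have hf : LipschitzWith 1 f := LipschitzWith.of_dist_le_mul fun z w => by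
    have h1 : dist (f z) (f w) = ‖(z : ℂ) - (w : ℂ)‖ / 2 := rfl
    have h2 : dist z w = ‖(z : ℂ) - (w : ℂ)‖ := by
      exact dist_eq_norm (z : ℂ) (w : ℂ)
    have h3 := norm_nonneg ((z : ℂ) - (w : ℂ))
    rw [h1, h2, NNReal.coe_one]
    linarith
  have hs : Function.Surjective f := fun z => ⟨z, rfl⟩
  exact hs.compactSpace hf.continuous

/-- The ternary predicate `P(u,v,w) = d(uv,w)`. -/
noncomputable def P (x : Fin 3 → HalfCircle) : unitInterval :=
  ⟨dist (x 0 * x 1) (x 2), dist_nonneg, dist_le_one _ _⟩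

/-- The signature whose only nonlogical symbol is a ternary predicate symbol, with modulus `Δ`. -/
def sig (Δ : Modulus) : Signature.{0} where
  Func := Empty
  funcArity := Empty.elim
  funcModulus := Empty.elim
  Pred := Unit
  predArity := fun _ => 3
  predModulus := fun _ => Δ

/-- The metric structure `(𝕊¹, P)`, for any modulus `Δ` respected by `P`. -/
noncomputable def str (Δ : Modulus) (hΔ : Respects Δ P) : Structure.{0, 0} (sig Δ) where
  carrier := HalfCircle
  dist_le_one := dist_le_one
  func := fun f => f.elim
  func_respects := fun f => f.elim
  pred := fun _ => P
  pred_respects := fun _ => hΔ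

/-- The squaring map `z ↦ z²`. -/
noncomputable def sq (z : HalfCircle) : HalfCircle := z ^ 2

end HalfCircle

end ContLogic

/-! Three things carry the proof. Formulas are uniformly continuous, so in a compact structure the
conditions are closed and saturation is the finite intersection property. The signature has no
function symbols, so every nonempty finite subset is a substructure; on a sufficiently fine net each
formula nearly keeps its value (`exists_dist_eval_restrict_le`). A sentence vanishing on all finite
structures therefore has value at most every `ε > 0` on a compact one: compact implies pseudofinite.
Strong pseudofiniteness fails because an exact value 0 can encode a failure of the pigeonhole
principle. `sqSentence` says that squaring is single-valued, onto, and identifies two points at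
distance 1. The circle satisfies it with `1` and `-1`. In a finite structure infima are attained, so
the zero set of `P(x,x,y)` would be the graph of a partial map from a finite set onto itself, hence
a bijection. -/

namespace ContLogic

/-! ### Uniform continuity of formulas -/

theorem dist_iSup_le {ι : Type*} [Nonempty ι] {f g : ι → unitInterval} {ε : ℝ}
    (h : ∀ i, dist (f i) (g i) ≤ ε) : dist (⨆ i, f i) (⨆ i, g i) ≤ ε := by
  have key : ∀ f g : ι → unitInterval, (∀ i, dist (f i) (g i) ≤ ε) →
      ((⨆ i, f i : unitInterval) : ℝ) ≤ ((⨆ i, g i : unitInterval) : ℝ) + ε := by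
    intro f g h
    have hε : 0 ≤ ε := dist_nonneg.trans (h (Classical.arbitrary ι))
    -- The shifted supremum is a candidate upper bound in `[0,1]` only if it is at most 1; otherwise
    -- the inequality is trivial.
    by_cases h1 : ((⨆ i, g i : unitInterval) : ℝ) + ε ≤ 1
    · have h2 : (⨆ i, f i) ≤
          (⟨((⨆ i, g i : unitInterval) : ℝ) + ε, add_nonneg (⨆ i, g i : unitInterval).2.1 hε, h1⟩ :
            unitInterval) := by
        refine iSup_le fun i => ?_
        have h3 : ((g i : unitInterval) : ℝ) ≤ ((⨆ i, g i : unitInterval) : ℝ) :=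
          Subtype.coe_le_coe.2 (le_iSup g i)
        have h4 := (abs_le.1 (h i : |((f i : ℝ)) - (g i : ℝ)| ≤ ε)).2
        exact Subtype.coe_le_coe.1 (by simp only; linarith)
      exact Subtype.coe_le_coe.2 h2
    · exact (Subtype.prop (⨆ i, f i)).2.trans (not_le.1 h1).le
  have h1 := key f g h
  have h2 := key g f fun i => by rw [dist_comm]; exact h i
  exact abs_le.2 ⟨by linarith, by linarith⟩

theorem dist_symm_symm (a b : unitInterval) :
    dist (unitInterval.symm a) (unitInterval.symm b) = dist a b := by
  rw [Subtype.dist_eq, Subtype.dist_eq, Real.dist_eq, Real.dist_eq, unitInterval.coe_symm_eq,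
    unitInterval.coe_symm_eq, abs_sub_comm]
  congr 1
  ring

theorem symm_iInf {ι : Type*} (f : ι → unitInterval) :
    unitInterval.symm (⨅ i, f i) = ⨆ i, unitInterval.symm (f i) := by
  apply le_antisymm
  · refine unitInterval.symm_le_comm.1 (le_iInf fun i => unitInterval.symm_le_comm.1 ?_)
    exact le_iSup (fun i => unitInterval.symm (f i)) i
  · exact iSup_le fun i => unitInterval.symm_le_symm.2 (iInf_le f i)

theorem dist_iInf_le {ι : Type*} [Nonempty ι] {f g : ι → unitInterval} {ε : ℝ}
    (h : ∀ i, dist (f i) (g i) ≤ ε) : dist (⨅ i, f i) (⨅ i, g i) ≤ ε := by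
  rw [← dist_symm_symm, symm_iInf, symm_iInf]
  exact dist_iSup_le fun i => by rw [dist_symm_symm]; exact h i

theorem Respects.uniformContinuous {X Y : Type*} [PseudoMetricSpace X] [PseudoMetricSpace Y]
    {Δ : Modulus} {f : X → Y} (h : Respects Δ f) : UniformContinuous f := by
  refine Metric.uniformContinuous_iff.2 fun ε hε => ?_
  have hm : 0 < min (ε / 2) 1 := lt_min (half_pos hε) one_pos
  refine ⟨Δ ⟨min (ε / 2) 1, hm, min_le_right _ _⟩, (Δ _).2.1, fun {a b} hab => ?_⟩
  exact (h _ a b hab).trans_lt ((min_le_left _ _).trans_lt (half_lt_self hε))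

theorem Term.uniformContinuous_eval {L : Signature.{u}} (M : Structure.{u, v} L) {n : ℕ}
    (t : Term L n) : UniformContinuous fun x : Fin n → M.carrier => t.eval M x := by
  induction t with
  | var i => exact Pi.uniformContinuous_proj _ i
  | app f ts ih => exact (M.func_respects f).uniformContinuous.comp (uniformContinuous_pi.2 ih)

theorem dist_snoc_snoc {X : Type*} [PseudoMetricSpace X] {n : ℕ} (x x' : Fin n → X) (y : X) :
    dist (Fin.snoc x y : Fin (n + 1) → X) (Fin.snoc x' y) ≤ dist x x' := by
  refine (dist_pi_le_iff dist_nonneg).2 fun i => ?_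
  refine Fin.lastCases ?_ (fun j => ?_) i
  · simp
  · simpa using dist_le_pi_dist x x' j

theorem dist_snoc_snoc_self {X : Type*} [PseudoMetricSpace X] {n : ℕ} (x : Fin n → X) (y y' : X) :
    dist (Fin.snoc x y : Fin (n + 1) → X) (Fin.snoc x y') ≤ dist y y' := by
  refine (dist_pi_le_iff dist_nonneg).2 fun i => ?_
  refine Fin.lastCases ?_ (fun j => ?_) i <;> simp

theorem Formula.uniformContinuous_eval {L : Signature.{u}} (M : Structure.{u, v} L) {n : ℕ}
    (φ : Formula L n) : UniformContinuous fun x : Fin n → M.carrier => φ.eval M x := by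
  induction φ with
  | dist s t =>
    exact (UniformContinuous.dist (s.uniformContinuous_eval M)
      (t.uniformContinuous_eval M)).subtype_mk _
  | pred P ts =>
    exact (M.pred_respects P).uniformContinuous.comp
      (uniformContinuous_pi.2 fun i => (ts i).uniformContinuous_eval M)
  | conn c φ ih =>
    exact (CompactSpace.uniformContinuous_of_continuous c.continuous).comp
      (uniformContinuous_pi.2 ih)
  | sup φ ih =>
    refine Metric.uniformContinuous_iff.2 fun ε hε => ?_
    obtain ⟨δ, hδ, h⟩ := Metric.uniformContinuous_iff.1 ih (ε / 2) (half_pos hε)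
    refine ⟨δ, hδ, fun {a b} hab => (dist_iSup_le fun y => ?_).trans_lt (half_lt_self hε)⟩
    exact (h ((dist_snoc_snoc a b y).trans_lt hab)).le
  | inf φ ih =>
    refine Metric.uniformContinuous_iff.2 fun ε hε => ?_
    obtain ⟨δ, hδ, h⟩ := Metric.uniformContinuous_iff.1 ih (ε / 2) (half_pos hε)
    refine ⟨δ, hδ, fun {a b} hab => (dist_iInf_le fun y => ?_).trans_lt (half_lt_self hε)⟩
    exact (h ((dist_snoc_snoc a b y).trans_lt hab)).le

/-! ### Finite nets and compact structures -/

namespace Structure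

variable {L : Signature.{u}}

/-- The structure induced on a finite nonempty subset, in a signature without function symbols. -/
@[reducible] def restrict [IsEmpty L.Func] (M : Structure.{u, v} L) (A : Set M.carrier) [Finite A]
    [Nonempty A] : Structure.{u, v} L where
  carrier := A
  dist_le_one x y := M.dist_le_one x y
  func f := isEmptyElim f
  func_respects f := isEmptyElim f
  pred P x := M.pred P fun i => x i
  pred_respects P ε _ _ h := M.pred_respects P ε _ _ h

theorem eval_term_restrict [IsEmpty L.Func] (M : Structure.{u, v} L) (A : Set M.carrier) [Finite A]
    [Nonempty A] {n : ℕ} (t : Term L n) (x : Fin n → A) :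
    ((t.eval (M.restrict A) x : A) : M.carrier) = t.eval M fun i => x i := by
  cases t with
  | var i => rfl
  | app f ts => exact (IsEmpty.false f).elim

theorem coe_snoc {X : Type*} {A : Set X} {n : ℕ} (x : Fin n → A) (a : A) :
    (fun i => ((Fin.snoc x a : Fin (n + 1) → A) i : X)) =
      (Fin.snoc (fun i => (x i : X)) (a : X) : Fin (n + 1) → X) := by
  funext i
  refine Fin.lastCases ?_ (fun j => ?_) i <;> simp

/-- Quantifying over a dense enough subset changes suprema and infima by little. -/
theorem dist_iSup_subtype_le {X : Type*} [Nonempty X] {A : Set X} [Nonempty A]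
    {f : X → unitInterval} {ε : ℝ} (h : ∀ x, ∃ a : A, dist (f a) (f x) ≤ ε) :
    dist (⨆ a : A, f a) (⨆ x, f x) ≤ ε := by
  choose r hr using h
  -- Reindexing by `X` makes `dist_iSup_le` applicable: the term at `x` lies between `f (r x)` and
  -- `max (f x) (f (r x))`, so within `ε` of `f x`.
  have h1 : (⨆ a : A, f a) = ⨆ x, (f x ⊔ f (r x)) ⊓ ⨆ a : A, f a := by
    apply le_antisymm
    · exact iSup_le fun a => le_trans (le_inf le_sup_left (le_iSup (fun a : A => f a) a))
        (le_iSup (fun x => (f x ⊔ f (r x)) ⊓ ⨆ a : A, f a) (a : X))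
    · exact iSup_le fun x => inf_le_right
  rw [h1]
  refine dist_iSup_le fun x => ?_
  have h2 : f (r x) ≤ (f x ⊔ f (r x)) ⊓ ⨆ a : A, f a :=
    le_inf le_sup_right (le_iSup (fun a : A => f a) (r x))
  have hε : 0 ≤ ε := dist_nonneg.trans (hr x)
  have h3 := abs_le.1 (hr x : |((f (r x)) : ℝ) - (f x : ℝ)| ≤ ε)
  have h4 : (((f x ⊔ f (r x)) ⊓ ⨆ a : A, f a : unitInterval) : ℝ) ≤
      max (f x : ℝ) (f (r x) : ℝ) := by
    rcases max_choice (f x) (f (r x)) with h | h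
    · exact (Subtype.coe_le_coe.2 (inf_le_left.trans h.le)).trans (le_max_left _ _)
    · exact (Subtype.coe_le_coe.2 (inf_le_left.trans h.le)).trans (le_max_right _ _)
  have h5 : max (f x : ℝ) (f (r x) : ℝ) ≤ f x + ε := max_le (by linarith) (by linarith)
  have h6 := Subtype.coe_le_coe.2 h2
  exact abs_le.2 ⟨by linarith, by linarith⟩

theorem dist_iInf_subtype_le {X : Type*} [Nonempty X] {A : Set X} [Nonempty A]
    {f : X → unitInterval} {ε : ℝ} (h : ∀ x, ∃ a : A, dist (f a) (f x) ≤ ε) :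
    dist (⨅ a : A, f a) (⨅ x, f x) ≤ ε := by
  rw [← dist_symm_symm, symm_iInf, symm_iInf]
  refine dist_iSup_subtype_le (f := fun x => unitInterval.symm (f x)) fun x => ?_
  obtain ⟨a, ha⟩ := h x
  exact ⟨a, by rwa [dist_symm_symm]⟩

/-- Induction on `φ`, with `δ` independent of the net `A`. Atomic values do not change at all. At a
quantifier, half of `ε` pays for evaluating `φ` in the net, the other half for letting the bound
variable range over the net only. -/
theorem exists_dist_eval_restrict_le [IsEmpty L.Func] (M : Structure.{u, v} L) {n : ℕ}
    (φ : Formula L n) : ∀ ε > (0 : ℝ), ∃ δ > (0 : ℝ),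
      ∀ (A : Set M.carrier) [Finite A] [Nonempty A], (∀ x, ∃ a : A, dist (a : M.carrier) x < δ) →
        ∀ x : Fin n → A, dist (φ.eval (M.restrict A) x) (φ.eval M fun i => x i) ≤ ε := by
  induction φ with
  | dist s t =>
    intro ε hε
    refine ⟨1, one_pos, fun A _ _ _ x => ?_⟩
    have h : Formula.eval (M.restrict A) (.dist s t) x = Formula.eval M (.dist s t) fun i => x i :=
      Subtype.ext <| by
        change dist (_ : M.carrier) (_ : M.carrier) = dist (_ : M.carrier) (_ : M.carrier)
        rw [eval_term_restrict, eval_term_restrict]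
    rw [h, dist_self]
    exact hε.le
  | pred P ts =>
    intro ε hε
    refine ⟨1, one_pos, fun A _ _ _ x => ?_⟩
    have h : Formula.eval (M.restrict A) (.pred P ts) x = Formula.eval M (.pred P ts) fun i => x i :=
      congrArg (M.pred P) (funext fun i => eval_term_restrict M A (ts i) x)
    rw [h, dist_self]
    exact hε.le
  | conn c φ ih =>
    intro ε hε
    obtain ⟨η, hη, hc⟩ := Metric.uniformContinuous_iff.1
      (CompactSpace.uniformContinuous_of_continuous c.continuous) ε hε
    choose δ hδ h using fun i => ih i (η / 2) (half_pos hη)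
    -- A common positive bound below the finitely many `δ i`; arguing with filters also covers `k =
    -- 0`.
    obtain ⟨δ', hle, hδ'⟩ := ((Filter.eventually_all.2 fun i =>
      nhdsWithin_le_nhds (eventually_lt_nhds (hδ i))).and
        (self_mem_nhdsWithin (s := Set.Ioi (0 : ℝ)))).exists
    refine ⟨δ', hδ', fun A _ _ hA x => (hc ?_).le⟩
    refine ((dist_pi_le_iff (half_pos hη).le).2 fun i => ?_).trans_lt (half_lt_self hη)
    exact h i A (fun y => (hA y).imp fun a ha => ha.trans (hle i)) x
  | sup φ ih =>
    intro ε hε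
    obtain ⟨δ₁, hδ₁, h₁⟩ := ih (ε / 2) (half_pos hε)
    obtain ⟨δ₂, hδ₂, h₂⟩ := Metric.uniformContinuous_iff.1 (φ.uniformContinuous_eval M) (ε / 2)
      (half_pos hε)
    refine ⟨min δ₁ δ₂, lt_min hδ₁ hδ₂, fun A _ _ hA x => ?_⟩
    have e₁ : dist (⨆ a : A, φ.eval (M.restrict A) (Fin.snoc x a))
        (⨆ a : A, φ.eval M (Fin.snoc (fun i => (x i : M.carrier)) (a : M.carrier))) ≤ ε / 2 :=
      dist_iSup_le fun a => by
        rw [← coe_snoc]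
        exact h₁ A (fun y => (hA y).imp fun a ha => ha.trans_le (min_le_left _ _)) _
    have e₂ : dist (⨆ a : A, φ.eval M (Fin.snoc (fun i => (x i : M.carrier)) (a : M.carrier)))
        (⨆ y, φ.eval M (Fin.snoc (fun i => (x i : M.carrier)) y)) ≤ ε / 2 :=
      dist_iSup_subtype_le (f := fun y => φ.eval M (Fin.snoc (fun i => (x i : M.carrier)) y))
        fun y => (hA y).imp fun a ha =>
        (h₂ ((dist_snoc_snoc_self _ _ _).trans_lt (ha.trans_le (min_le_right _ _)))).le
    exact (dist_triangle _ _ _).trans ((add_le_add e₁ e₂).trans (add_halves ε).le)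
  | inf φ ih =>
    intro ε hε
    obtain ⟨δ₁, hδ₁, h₁⟩ := ih (ε / 2) (half_pos hε)
    obtain ⟨δ₂, hδ₂, h₂⟩ := Metric.uniformContinuous_iff.1 (φ.uniformContinuous_eval M) (ε / 2)
      (half_pos hε)
    refine ⟨min δ₁ δ₂, lt_min hδ₁ hδ₂, fun A _ _ hA x => ?_⟩
    have e₁ : dist (⨅ a : A, φ.eval (M.restrict A) (Fin.snoc x a))
        (⨅ a : A, φ.eval M (Fin.snoc (fun i => (x i : M.carrier)) (a : M.carrier))) ≤ ε / 2 :=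
      dist_iInf_le fun a => by
        rw [← coe_snoc]
        exact h₁ A (fun y => (hA y).imp fun a ha => ha.trans_le (min_le_left _ _)) _
    have e₂ : dist (⨅ a : A, φ.eval M (Fin.snoc (fun i => (x i : M.carrier)) (a : M.carrier)))
        (⨅ y, φ.eval M (Fin.snoc (fun i => (x i : M.carrier)) y)) ≤ ε / 2 :=
      dist_iInf_subtype_le (f := fun y => φ.eval M (Fin.snoc (fun i => (x i : M.carrier)) y))
        fun y => (hA y).imp fun a ha =>
        (h₂ ((dist_snoc_snoc_self _ _ _).trans_lt (ha.trans_le (min_le_right _ _)))).le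
    exact (dist_triangle _ _ _).trans ((add_le_add e₁ e₂).trans (add_halves ε).le)

/-- Compact structures in a signature without function symbols are pseudofinite. -/
theorem IsCompact.pseudofinite [IsEmpty L.Func] {M : Structure.{u, v} L} (hM : M.IsCompact) :
    M.Pseudofinite := by
  intro σ hσ
  have : CompactSpace M.carrier := hM
  refine dist_le_zero.1 (le_of_forall_pos_le_add fun ε hε => ?_)
  obtain ⟨δ, hδ, h⟩ := M.exists_dist_eval_restrict_le σ ε hε
  obtain ⟨t, -, ht, hcov⟩ := finite_cover_balls_of_compact (isCompact_univ (X := M.carrier)) hδ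
  have hA : ∀ x, ∃ a : t, dist (a : M.carrier) x < δ := fun x => by
    obtain ⟨a, ha, hx⟩ := Set.mem_iUnion₂.1 (hcov (Set.mem_univ x))
    exact ⟨⟨a, ha⟩, by rw [dist_comm]; exact hx⟩
  have : Finite t := ht
  have : Nonempty t := (hA (Classical.arbitrary _)).nonempty
  have h1 := h t hA Fin.elim0
  have h2 : Formula.eval (M.restrict t) σ Fin.elim0 = 0 := hσ (M.restrict t) ht
  rw [h2, dist_comm] at h1
  rw [Subsingleton.elim (fun i => ((Fin.elim0 i : t) : M.carrier)) Fin.elim0] at h1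
  exact h1.trans (zero_add ε).ge

theorem IsCompact.stronglyPseudocompact {M : Structure.{u, v} L} (hM : M.IsCompact) :
    M.StronglyPseudocompact := fun _ hσ => ⟨M, hM, hσ⟩

theorem Condition.isClosed_holds {M : Structure.{u, v} L} {A : Set M.carrier} {n : ℕ}
    (c : M.Condition A n) : IsClosed {x | c.Holds x} := by
  refine isClosed_eq ((c.formula.uniformContinuous_eval M).continuous.comp ?_) continuous_const
  refine continuous_pi fun i => ?_
  refine Fin.addCases (fun j => ?_) (fun j => ?_) i
  · simpa using continuous_apply j
  · simpa using continuous_const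

theorem IsCompact.saturated {M : Structure.{u, v} L} (hM : M.IsCompact) (κ : Cardinal.{v}) :
    M.Saturated κ := by
  intro A _ n Γ hΓ
  have : CompactSpace M.carrier := hM
  obtain ⟨x, hx⟩ := CompactSpace.iInter_nonempty (t := fun c : Γ => {x | c.1.Holds x})
    (fun c => c.1.isClosed_holds) fun s => by
      obtain ⟨x, hx⟩ := hΓ (Subtype.val '' (s : Set Γ)) (by rintro _ ⟨c, -, rfl⟩; exact c.2)
        (s.finite_toSet.image _)
      exact ⟨x, Set.mem_iInter₂.2 fun c hc => hx c ⟨c, hc, rfl⟩⟩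
  exact ⟨x, fun c hc => Set.mem_iInter.1 hx ⟨c, hc⟩⟩

end Structure

/-! ### Squaring on the circle and the separating sentence -/

namespace HalfCircle

theorem toComplex_mul (z w : HalfCircle) : (z * w).toComplex = z.toComplex * w.toComplex :=
  map_mul Circle.coeHom z w

theorem norm_toComplex (z : HalfCircle) : ‖z.toComplex‖ = 1 := Circle.norm_coe z

theorem dist_mul_mul_le (u v u' v' : HalfCircle) :
    dist (u * v) (u' * v') ≤ dist u u' + dist v v' := by
  rw [dist_eq, dist_eq, dist_eq, toComplex_mul, toComplex_mul]
  have h : u.toComplex * v.toComplex - u'.toComplex * v'.toComplex =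
      (u.toComplex - u'.toComplex) * v.toComplex + u'.toComplex * (v.toComplex - v'.toComplex) := by
    ring
  have h1 := norm_add_le ((u.toComplex - u'.toComplex) * v.toComplex)
    (u'.toComplex * (v.toComplex - v'.toComplex))
  rw [norm_mul, norm_mul, norm_toComplex, norm_toComplex, ← h] at h1
  linarith

theorem exists_respects_P : ∃ Δ : Modulus, Respects Δ P := by
  -- `P` is 1-Lipschitz in each of its three arguments, whence `ε / 3`.
  refine ⟨fun ε => ⟨ε / 3, by linarith [ε.2.1], by linarith [ε.2.1, ε.2.2]⟩, fun ε x y h => ?_⟩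
  have h0 := dist_le_pi_dist x y 0
  have h1 := dist_le_pi_dist x y 1
  have h2 := dist_le_pi_dist x y 2
  have h3 := dist_mul_mul_le (x 0) (x 1) (y 0) (y 1)
  have h4 := dist_dist_dist_le (x 0 * x 1) (x 2) (y 0 * y 1) (y 2)
  have h5 : dist (P x) (P y) = dist (dist (x 0 * x 1) (x 2)) (dist (y 0 * y 1) (y 2)) := rfl
  rw [h5]
  simp only at h
  linarith

theorem sq_surjective : Function.Surjective sq := fun z => by
  refine ⟨Circle.exp (Complex.arg z.toComplex / 2), ?_⟩
  have h : Circle.exp (Complex.arg z.toComplex / 2) ^ 2 = Circle.exp (Complex.arg z.toComplex) := by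
    rw [pow_two, ← Circle.exp_add, add_halves]
  exact h.trans (Circle.exp_arg z)

/-- The point `-1` of the circle. -/
noncomputable def negOne : HalfCircle := Circle.exp Real.pi

theorem toComplex_negOne : negOne.toComplex = -1 := by
  change ((Circle.exp Real.pi : Circle) : ℂ) = -1
  rw [Circle.coe_exp, Complex.exp_pi_mul_I]

theorem toComplex_one : (1 : HalfCircle).toComplex = 1 := map_one Circle.coeHom

theorem negOne_mul_negOne : negOne * negOne = 1 := by
  apply Circle.coe_injective
  change (negOne * negOne).toComplex = (1 : HalfCircle).toComplex
  rw [toComplex_mul, toComplex_negOne, toComplex_one]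
  norm_num

theorem dist_one_negOne : dist (1 : HalfCircle) negOne = 1 := by
  rw [dist_eq, toComplex_negOne, toComplex_one]
  norm_num

theorem sq_not_injective : ¬ Function.Injective sq := fun h => by
  have h1 : (1 : HalfCircle) = negOne := h (by simp only [sq, pow_two, negOne_mul_negOne, one_mul])
  have h2 := dist_one_negOne
  rw [← h1, dist_self] at h2
  exact zero_ne_one h2

theorem dist_sq (z w : HalfCircle) : dist (sq z) w = (P ![z, z, w] : ℝ) := by
  change dist (z ^ 2) w = dist (z * z) w
  rw [pow_two]

instance (Δ : Modulus) : IsEmpty (sig Δ).Func := inferInstanceAs (IsEmpty Empty)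

/-- The formula `P(xᵢ, xᵢ, xⱼ)`. -/
def sqFormula (Δ : Modulus) {n : ℕ} (i j : Fin n) : Formula (sig Δ) n :=
  .pred (L := sig Δ) () ![.var i, .var i, .var j]

/-- The value `P(x, x, y)` in an arbitrary structure. -/
def sqVal {Δ : Modulus} (M : Structure.{0, 0} (sig Δ)) (x y : M.carrier) : unitInterval :=
  M.pred () ![x, x, y]

theorem eval_sqFormula {Δ : Modulus} (M : Structure.{0, 0} (sig Δ)) {n : ℕ} (i j : Fin n)
    (x : Fin n → M.carrier) : (sqFormula Δ i j).eval M x = sqVal M (x i) (x j) := by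
  refine congrArg (M.pred ()) (funext fun k => ?_)
  change Fin 3 at k
  fin_cases k <;> rfl

theorem formulaDefinable_sq (Δ : Modulus) (hΔ : Respects Δ P) :
    (str Δ hΔ).FormulaDefinable sq := by
  refine ⟨0, sqFormula Δ 0 1, Fin.elim0, fun x y => ?_⟩
  rw [eval_sqFormula]
  exact dist_sq x y

/-- The maximum of two formulas. -/
def maxFormula {L : Signature.{0}} {n : ℕ} (φ ψ : Formula L n) : Formula L n :=
  .conn (k := 2) ⟨fun v => v 0 ⊔ v 1, by fun_prop⟩ ![φ, ψ]

theorem eval_maxFormula_eq_zero {L : Signature.{0}} (M : Structure.{0, 0} L) {n : ℕ}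
    (φ ψ : Formula L n) (x : Fin n → M.carrier) :
    (maxFormula φ ψ).eval M x = 0 ↔ φ.eval M x = 0 ∧ ψ.eval M x = 0 :=
  sup_eq_bot_iff (α := unitInterval)

/-- The formula `1 - d(xᵢ, xⱼ)`. -/
def farFormula (L : Signature.{0}) {n : ℕ} (i j : Fin n) : Formula L n :=
  .conn (k := 1) ⟨fun v => unitInterval.symm (v 0), by fun_prop⟩ ![.dist (.var i) (.var j)]

theorem eval_farFormula_eq_zero {L : Signature.{0}} (M : Structure.{0, 0} L) {n : ℕ}
    (i j : Fin n) (x : Fin n → M.carrier) :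
    (farFormula L i j).eval M x = 0 ↔ dist (x i) (x j) = 1 := by
  change unitInterval.symm ⟨dist (x i) (x j), dist_nonneg, M.dist_le_one _ _⟩ = 0 ↔ _
  rw [Subtype.ext_iff, unitInterval.coe_symm_eq]
  change 1 - dist (x i) (x j) = 0 ↔ _
  rw [sub_eq_zero, eq_comm]

/-- The formula `max(0, d(xⱼ, xₖ) - P(xᵢ, xᵢ, xⱼ) - P(xᵢ, xᵢ, xₖ))`. -/
noncomputable def uniqueFormula (Δ : Modulus) {n : ℕ} (i j k : Fin n) : Formula (sig Δ) n :=
  .conn (k := 3) ⟨fun v => Set.projIcc 0 1 zero_le_one ((v 0 : ℝ) - v 1 - v 2),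
    continuous_projIcc.comp (by fun_prop)⟩
    ![.dist (.var j) (.var k), sqFormula Δ i j, sqFormula Δ i k]

theorem eval_uniqueFormula_eq_zero {Δ : Modulus} (M : Structure.{0, 0} (sig Δ)) {n : ℕ}
    (i j k : Fin n) (x : Fin n → M.carrier) : (uniqueFormula Δ i j k).eval M x = 0 ↔
      dist (x j) (x k) ≤ (sqVal M (x i) (x j) : ℝ) + sqVal M (x i) (x k) := by
  have h : (uniqueFormula Δ i j k).eval M x = Set.projIcc 0 1 zero_le_one
      (dist (x j) (x k) - ((sqFormula Δ i j).eval M x : ℝ) - ((sqFormula Δ i k).eval M x : ℝ)) :=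
    rfl
  rw [h, eval_sqFormula, eval_sqFormula]
  refine (Set.projIcc_eq_left (zero_lt_one' ℝ)).trans ?_
  rw [sub_sub, sub_nonpos]

/-- A sentence saying that `P(x, x, y) = 0` is the graph of a partial function which is onto and
not one-to-one. -/
noncomputable def sqSentence (Δ : Modulus) : Sentence (sig Δ) :=
  maxFormula (.sup (.sup (.sup (uniqueFormula Δ 0 1 2))))
    -- Variables are numbered from the outermost quantifier inwards: here 0 is the target and 1 its
    -- square root.
    (maxFormula (.sup (.inf (sqFormula Δ 1 0)))
      -- Mere distinctness is not a closed condition; distance exactly 1 is, and `1` and `-1`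
      -- realise it.
      (.inf (.inf (.inf (maxFormula (farFormula _ 0 1)
        (maxFormula (sqFormula Δ 0 2) (sqFormula Δ 1 2)))))))

theorem eval_sup_eq_zero {L : Signature.{0}} (M : Structure.{0, 0} L) {n : ℕ}
    (φ : Formula L (n + 1)) (x : Fin n → M.carrier) :
    (Formula.sup φ).eval M x = 0 ↔ ∀ y, φ.eval M (Fin.snoc x y) = 0 :=
  iSup_eq_bot (α := unitInterval)

theorem eval_inf_eq_zero_of_exists {L : Signature.{0}} (M : Structure.{0, 0} L) {n : ℕ}
    {φ : Formula L (n + 1)} {x : Fin n → M.carrier} (h : ∃ y, φ.eval M (Fin.snoc x y) = 0) :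
    (Formula.inf φ).eval M x = 0 := by
  obtain ⟨y, hy⟩ := h
  exact le_antisymm ((iInf_le (fun y => φ.eval M (Fin.snoc x y)) y).trans hy.le) bot_le

/-- A finite infimum is attained, so a zero infimum has an exact witness; in general it yields only
approximate ones. -/
theorem exists_of_eval_inf_eq_zero {L : Signature.{0}} {M : Structure.{0, 0} L} (hM : M.IsFinite)
    {n : ℕ} {φ : Formula L (n + 1)} {x : Fin n → M.carrier} (h : (Formula.inf φ).eval M x = 0) :
    ∃ y, φ.eval M (Fin.snoc x y) = 0 := by
  have : Finite M.carrier := hM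
  obtain ⟨y, hy⟩ := exists_eq_ciInf_of_finite (f := fun y => φ.eval M (Fin.snoc x y))
  exact ⟨y, hy.trans h⟩

theorem sqVal_str (Δ : Modulus) (hΔ : Respects Δ P) (x y : HalfCircle) :
    (sqVal (str Δ hΔ) x y : ℝ) = dist (sq x) y := (dist_sq x y).symm

theorem sqVal_str_eq_zero (Δ : Modulus) (hΔ : Respects Δ P) {x y : HalfCircle} (h : sq x = y) :
    sqVal (str Δ hΔ) x y = 0 :=
  Subtype.ext <| (sqVal_str Δ hΔ x y).trans (by rw [h, dist_self]; rfl)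

theorem value_sqSentence_str (Δ : Modulus) (hΔ : Respects Δ P) :
    (sqSentence Δ).value (str Δ hΔ) = 0 := by
  refine (eval_maxFormula_eq_zero _ _ _ _).2 ⟨?_, (eval_maxFormula_eq_zero _ _ _ _).2 ⟨?_, ?_⟩⟩
  · refine (eval_sup_eq_zero _ _ _).2 fun x => (eval_sup_eq_zero _ _ _).2 fun y =>
      (eval_sup_eq_zero _ _ _).2 fun z => (eval_uniqueFormula_eq_zero _ _ _ _ _).2 ?_
    -- Triangle inequality through `sq x`.
    exact (dist_triangle_left (y : HalfCircle) z (sq x)).trans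
      (add_le_add (sqVal_str Δ hΔ x y).ge (sqVal_str Δ hΔ x z).ge)
  · refine (eval_sup_eq_zero _ _ _).2 fun y => eval_inf_eq_zero_of_exists _ ?_
    obtain ⟨x, hx⟩ := sq_surjective y
    exact ⟨x, (eval_sqFormula _ _ _ _).trans (sqVal_str_eq_zero Δ hΔ hx)⟩
  · refine eval_inf_eq_zero_of_exists _ ⟨(1 : HalfCircle), eval_inf_eq_zero_of_exists _
      ⟨negOne, eval_inf_eq_zero_of_exists _ ⟨(1 : HalfCircle), ?_⟩⟩⟩
    refine (eval_maxFormula_eq_zero _ _ _ _).2 ⟨(eval_farFormula_eq_zero _ _ _ _).2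
      dist_one_negOne, (eval_maxFormula_eq_zero _ _ _ _).2
      ⟨(eval_sqFormula _ _ _ _).trans (sqVal_str_eq_zero Δ hΔ ?_),
        (eval_sqFormula _ _ _ _).trans (sqVal_str_eq_zero Δ hΔ ?_)⟩⟩
    · exact one_pow 2
    · exact (pow_two negOne).trans negOne_mul_negOne

theorem value_sqSentence_ne_zero {Δ : Modulus} {A : Structure.{0, 0} (sig Δ)} (hA : A.IsFinite) :
    (sqSentence Δ).value A ≠ 0 := by
  intro h
  obtain ⟨h1, h⟩ := (eval_maxFormula_eq_zero _ _ _ _).1 h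
  obtain ⟨h2, h3⟩ := (eval_maxFormula_eq_zero _ _ _ _).1 h
  have huniq : ∀ x y z : A.carrier, sqVal A x y = 0 → sqVal A x z = 0 → y = z := by
    intro x y z hy hz
    have h4 : dist y z ≤ (sqVal A x y : ℝ) + sqVal A x z :=
      (eval_uniqueFormula_eq_zero _ _ _ _ _).1
        ((eval_sup_eq_zero _ _ _).1 ((eval_sup_eq_zero _ _ _).1 ((eval_sup_eq_zero _ _ _).1 h1 x) y)
          z)
    rw [hy, hz] at h4
    exact dist_le_zero.1 (h4.trans (add_zero (0 : ℝ)).le)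
  have hsurj : ∀ y : A.carrier, ∃ x, sqVal A x y = 0 := fun y => by
    obtain ⟨x, hx⟩ := exists_of_eval_inf_eq_zero hA ((eval_sup_eq_zero _ _ _).1 h2 y)
    exact ⟨x, (eval_sqFormula _ _ _ _).symm.trans hx⟩
  obtain ⟨x, h3⟩ := exists_of_eval_inf_eq_zero hA h3
  obtain ⟨x', h3⟩ := exists_of_eval_inf_eq_zero hA h3
  obtain ⟨y, h3⟩ := exists_of_eval_inf_eq_zero hA h3
  obtain ⟨hfar, h3⟩ := (eval_maxFormula_eq_zero _ _ _ _).1 h3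
  obtain ⟨hx, hx'⟩ := (eval_maxFormula_eq_zero _ _ _ _).1 h3
  replace hfar : dist x x' = 1 := (eval_farFormula_eq_zero _ _ _ _).1 hfar
  replace hx : sqVal A x y = 0 := (eval_sqFormula _ _ _ _).symm.trans hx
  replace hx' : sqVal A x' y = 0 := (eval_sqFormula _ _ _ _).symm.trans hx'
  -- A choice `g` of square roots is injective by uniqueness of squares, hence onto by finiteness.
  -- So `x = g a` and `x' = g b`; both have square `y`, which forces `a = y = b` and contradicts
  -- `dist x x' = 1`.
  choose g hg using hsurj
  have : Finite A.carrier := hA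
  have hg_inj : Function.Injective g := fun a b hab => huniq (g a) a b (hg a) (hab ▸ hg b)
  have hg_surj := Finite.surjective_of_injective hg_inj
  obtain ⟨a, rfl⟩ := hg_surj x
  obtain ⟨b, rfl⟩ := hg_surj x'
  rw [huniq _ _ _ (hg a) hx, huniq _ _ _ (hg b) hx', dist_self] at hfar
  exact zero_ne_one hfar

theorem not_stronglyPseudofinite_str (Δ : Modulus) (hΔ : Respects Δ P) :
    ¬ (str Δ hΔ).StronglyPseudofinite := fun h => by
  obtain ⟨A, hA, h0⟩ := h (sqSentence Δ) (value_sqSentence_str Δ hΔ)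
  exact value_sqSentence_ne_zero hA h0

theorem isCompact_str (Δ : Modulus) (hΔ : Respects Δ P) : (str Δ hΔ).IsCompact :=
  inferInstanceAs (CompactSpace HalfCircle)

end HalfCircle

end ContLogic

theorem mainTheorem8 :
    -- `P` has a modulus of uniform continuity, so that `(𝕊¹, P)` is a metric structure
    (∃ Δ : ContLogic.Modulus, ContLogic.Respects Δ ContLogic.HalfCircle.P) ∧
    -- and for every such modulus:
    (∀ (Δ : ContLogic.Modulus) (hΔ : ContLogic.Respects Δ ContLogic.HalfCircle.P),
      (ContLogic.HalfCircle.str Δ hΔ).IsCompact ∧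
      (ContLogic.HalfCircle.str Δ hΔ).Pseudofinite ∧
      (ContLogic.HalfCircle.str Δ hΔ).StronglyPseudocompact ∧
      (∀ κ : Cardinal.{0}, (ContLogic.HalfCircle.str Δ hΔ).Saturated κ) ∧
      (∀ z w : ContLogic.HalfCircle,
        dist (ContLogic.HalfCircle.sq z) w = (ContLogic.HalfCircle.P ![z, z, w] : ℝ)) ∧
      (ContLogic.HalfCircle.str Δ hΔ).FormulaDefinable ContLogic.HalfCircle.sq ∧
      Function.Surjective ContLogic.HalfCircle.sq ∧
      ¬ Function.Injective ContLogic.HalfCircle.sq ∧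
      ¬ (ContLogic.HalfCircle.str Δ hΔ).StronglyPseudofinite) ∧
    -- hence the notions differ
    (∃ (L : ContLogic.Signature.{0}) (M : ContLogic.Structure.{0, 0} L),
      M.Pseudofinite ∧ ¬ M.StronglyPseudofinite) ∧
    (∃ (L : ContLogic.Signature.{0}) (M : ContLogic.Structure.{0, 0} L),
      M.StronglyPseudocompact ∧ ¬ M.StronglyPseudofinite) := by
  obtain ⟨Δ, hΔ⟩ := ContLogic.HalfCircle.exists_respects_P
  have hc := ContLogic.HalfCircle.isCompact_str
  have hn := ContLogic.HalfCircle.not_stronglyPseudofinite_str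
  exact ⟨⟨Δ, hΔ⟩, fun Δ hΔ => ⟨hc Δ hΔ, (hc Δ hΔ).pseudofinite, (hc Δ hΔ).stronglyPseudocompact,
      (hc Δ hΔ).saturated, ContLogic.HalfCircle.dist_sq,
      ContLogic.HalfCircle.formulaDefinable_sq Δ hΔ, ContLogic.HalfCircle.sq_surjective,
      ContLogic.HalfCircle.sq_not_injective, hn Δ hΔ⟩,
    ⟨_, _, (hc Δ hΔ).pseudofinite, hn Δ hΔ⟩,
    ⟨_, _, (hc Δ hΔ).stronglyPseudocompact, hn Δ hΔ⟩⟩
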